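/- Let $M$ be a smooth finite-dimensional manifold with a symplectic form $\omega$ (a smooth, closed, nondegenerate 2-form) that is exact, $\omega=-d\theta$ for a smooth 1-form $\theta$ on $M$. Let $G$ be a finite-dimensional Lie group with Lie algebra $\mathfrak g$, and let $\Phi:G\times M\to M$, $\Phi_g(x)=\Phi(g,x)$, be a smooth left action which is symplectic, i.e. $\Phi_g^*\omega=\omega$ for all $g\in G$, and which leaves $\theta$ invariant, i.e. $\Phi_g^*\theta=\theta$ for all $g\in G$. For $\xi\in\mathfrak g$ let $\xi_M(x)=\left.\frac{d}{dt}\right|_{t=0}\Phi(\exp(t\xi),x)$ be the infinitesimal generator of the action. Then the formula $$J(x)\xi=\theta_x(\xi_M(x)),\qquad x\in M,\ \xi\in\mathfrak g,$$ defines a smooth map $J:M\to\mathfrak g^*$ (in particular $J(x)$ is linear in $\xi$), and $J$ is an $\mathrm{Ad}^*$-equivariant momentum map for the action, that is: 1. for every $\xi\in\mathfrak g$, the function $\hat J(\xi):M\to\mathbb R$, $\hat J(\xi)(x)=J(x)\xi$, satisfies $d\hat J(\xi)=i_{\xi_M}\omega$, where $(i_{\xi_M}\omega)(v)=\omega(\xi_M,v)$;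 2. for all $g\in G$ and $x\in M$, $J(\Phi_g(x))=\mathrm{Ad}^*_{g^{-1}}J(x)$, where $(\mathrm{Ad}^*_{g^{-1}}\mu)(\xi)=\mu(\mathrm{Ad}_{g^{-1}}\xi)$. -/

import Mathlib

open scoped Manifold ContDiff

noncomputable section

namespace ExactMomentum

/-! ### Differential forms on a manifold -/

section Forms

variable {E : Type*} [NormedAddCommGroup E] [NormedSpace ℝ E]
  {H : Type*} [TopologicalSpace H] (I : ModelWithCorners ℝ E H)
  (M : Type*) [TopologicalSpace M] [ChartedSpace H M]
  {E' : Type*} [NormedAddCommGroup E'] [NormedSpace ℝ E']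
  {H' : Type*} [TopologicalSpace H'] (I' : ModelWithCorners ℝ E' H')
  {M' : Type*} [TopologicalSpace M'] [ChartedSpace H' M']

/-- A (not necessarily smooth) real differential `k`-form on `M`: an alternating `k`-linear form
on each tangent space. -/
abbrev Form (k : ℕ) : Type _ := ∀ x : M, (TangentSpace I x) [⋀^Fin k]→L[ℝ] ℝ

variable {M} {k : ℕ}

/-- The pullback `f^* Ω`, with `(f^* Ω)_x(v₁, …, v_k) = Ω_{f x}(df_x v₁, …, df_x v_k)`. -/
def Form.pullback (f : M → M') (Ω : Form I' M' k) : Form I M k := fun x =>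
  (Ω (f x)).compContinuousLinearMap (mfderiv I I' f x)

/-- The expression `(φ⁻¹)^* Ω` of a form in the chart `φ` of the manifold around `x₀`, as a form on
the model vector space (it is meaningful on the target of the chart). -/
def Form.inChart (Ω : Form I M k) (x₀ : M) : E → E [⋀^Fin k]→L[ℝ] ℝ := fun u =>
  (Ω ((extChartAt I x₀).symm u)).compContinuousLinearMap
    (mfderiv 𝓘(ℝ, E) I (extChartAt I x₀).symm u)

/-- A form is smooth if its expressions in the charts are smooth. -/
def Form.IsSmooth (Ω : Form I M k) : Prop :=
  ∀ x₀ : M, ContDiffOn ℝ ∞ (Form.inChart I Ω x₀) (extChartAt I x₀).target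

/-- The exterior derivative `(dΩ)_x = φ^* (d ((φ⁻¹)^* Ω))` at `x`, computed in the chart `φ` of the
manifold around `x`. -/
def Form.d (Ω : Form I M k) : Form I M (k + 1) := fun x =>
  (extDeriv (Form.inChart I Ω x) (extChartAt I x x)).compContinuousLinearMap
    (mfderiv I 𝓘(ℝ, E) (extChartAt I x) x)

/-- A symplectic form: a smooth, closed, nondegenerate 2-form. -/
structure IsSymplecticForm (Ω : Form I M 2) : Prop where
  smooth : Form.IsSmooth I Ω
  closed : Form.d I Ω = 0
  nondegenerate : ∀ (x : M) (v : TangentSpace I x), (∀ w : TangentSpace I x, Ω x ![v, w] = 0) → v = 0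

end Forms

/-! ### Lie groups: exponential map, adjoint and coadjoint representation -/

section LieGroup

variable {EG : Type*} [NormedAddCommGroup EG] [NormedSpace ℝ EG]
  {HG : Type*} [TopologicalSpace HG] (IG : ModelWithCorners ℝ EG HG)
  (G : Type*) [TopologicalSpace G] [ChartedSpace HG G] [Group G]

/-- The dual `𝔤^*` of the Lie algebra (all linear forms, since `𝔤` will be finite-dimensional). -/
abbrev LieDual : Type _ := GroupLieAlgebra IG G →L[ℝ] ℝ

variable {G}

/-- `Ad_g ξ` is the derivative at the identity of the conjugation `h ↦ g h g⁻¹`, applied to `ξ`. -/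
def Ad (g : G) : GroupLieAlgebra IG G →L[ℝ] GroupLieAlgebra IG G :=
  (mfderiv IG IG (fun h : G => g * h * g⁻¹) 1 : EG →L[ℝ] EG)

/-- `Ad^*_g` is the transpose of `Ad_g`, i.e. `(Ad^*_g μ) ξ = μ (Ad_g ξ)`. -/
def coAd (g : G) (μ : LieDual IG G) : LieDual IG G := μ.comp (Ad IG g)

variable [FiniteDimensional ℝ EG] [IG.Boundaryless] [LieGroup IG ∞ G]

/-- Left-invariant vector fields are complete: they have a global integral curve through the
identity. -/
theorem exists_integralCurve (ξ : GroupLieAlgebra IG G) :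
    ∃ γ : ℝ → G, γ 0 = 1 ∧ IsMIntegralCurve γ (mulInvariantVectorField (I := IG) ξ) := by
  have : CompleteSpace EG := FiniteDimensional.complete ℝ EG
  have : IsManifold IG 1 G := IsManifold.of_le (m := 1) (n := ∞) (by simp)
  have : LieGroup IG (minSmoothness ℝ 3) G := by
    rw [minSmoothness_of_isRCLikeNormedField]; infer_instance
  have : IsTopologicalGroup G := topologicalGroup_of_lieGroup IG ∞
  have : T1Space G := IG.t1Space G
  have hv : ContMDiff IG IG.tangent 1 (fun g : G =>
      (⟨g, mulInvariantVectorField (I := IG) ξ g⟩ : TangentBundle IG G)) :=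
    (contMDiff_mulInvariantVectorField ξ).of_le (by simp)
  obtain ⟨γ, h0, hγ⟩ := exists_isMIntegralCurveAt_of_contMDiffAt_boundaryless (I := IG) 0
    (hv.contMDiffAt (x := (1 : G)))
  obtain ⟨ε, hε, hγ⟩ := isMIntegralCurveAt_iff'.1 hγ
  refine exists_isMIntegralCurve_of_isMIntegralCurveOn hv hε (fun x => ?_) 1
  refine ⟨fun t => x * γ t, by simp [h0], fun t ht => ?_⟩
  have hdiff : ∀ a b : G, MDifferentiableAt IG IG (fun y : G => a * y) b := fun a b =>
    (contMDiff_mul_left (n := ∞)).contMDiffAt.mdifferentiableAt (by simp)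
  have hinv : mulInvariantVectorField (I := IG) ξ (x * γ t) =
      mfderiv IG IG (fun y : G => x * y) (γ t) (mulInvariantVectorField (I := IG) ξ (γ t)) := by
    have hc : (fun y : G => x * γ t * y) = (fun y : G => x * y) ∘ (fun y : G => γ t * y) := by
      ext y; simp [mul_assoc]
    have hd := mfderiv_comp (1 : G) (hdiff x (γ t * 1)) (hdiff (γ t) 1)
    rw [← hc] at hd
    have he : ∀ b : G, b = γ t → (mfderiv IG IG (fun y : G => x * y) b : EG →L[ℝ] EG) =
        mfderiv IG IG (fun y : G => x * y) (γ t) := by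
      rintro b rfl; rfl
    exact (DFunLike.congr_fun hd ξ).trans (DFunLike.congr_fun (he (γ t * 1) (mul_one _))
      (mulInvariantVectorField (I := IG) ξ (γ t)))
  have h1 := hγ t (by simpa [Real.ball_eq_Ioo] using ht)
  have h2 := (hdiff x (γ t)).hasMFDerivAt.comp_hasMFDerivWithinAt t h1
  rw [Real.ball_eq_Ioo, zero_sub, zero_add] at h2
  have h3 : (mfderiv IG IG (fun y : G => x * y) (γ t)).comp
      ((1 : ℝ →L[ℝ] ℝ).smulRight (mulInvariantVectorField (I := IG) ξ (γ t))) =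
      (1 : ℝ →L[ℝ] ℝ).smulRight (mulInvariantVectorField (I := IG) ξ (x * γ t)) := by
    rw [hinv]
    refine ContinuousLinearMap.ext fun s => ?_
    exact map_smul (mfderiv IG IG (fun y : G => x * y) (γ t)) s _
  rw [← h3]
  exact h2

/-- The integral curve through the identity, defined on all of `ℝ`, of the left-invariant vector
field with value `ξ` at the identity. -/
def expCurve (ξ : GroupLieAlgebra IG G) : ℝ → G := (exists_integralCurve IG ξ).choose

/-- The exponential map of the Lie group. -/
def lieExp (ξ : GroupLieAlgebra IG G) : G := expCurve IG ξ 1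

variable {E : Type*} [NormedAddCommGroup E] [NormedSpace ℝ E]
  {H : Type*} [TopologicalSpace H] (I : ModelWithCorners ℝ E H)
  {M : Type*} [TopologicalSpace M] [ChartedSpace H M] [MulAction G M]

/-- The infinitesimal generator `ξ_M(x) = d/dt (exp(tξ) • x)` at `t = 0` of an action. -/
def generator (ξ : GroupLieAlgebra IG G) (x : M) : TangentSpace I x :=
  (mfderiv 𝓘(ℝ, ℝ) I (fun t : ℝ => lieExp IG (t • ξ) • x) 0 : ℝ →L[ℝ] E) 1

/-- `J : M → 𝔤^*` is a momentum map for the action of `G` on `(M, Ω)`: it is smooth, and for every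
`ξ` the function `Ĵ(ξ) = (x ↦ J(x) ξ)` satisfies `d Ĵ(ξ) = i_{ξ_M} Ω`. -/
structure IsMomentumMap (Ω : Form I M 2) (J : M → LieDual IG G) : Prop where
  smooth : ContMDiff (M' := EG →L[ℝ] ℝ) I 𝓘(ℝ, EG →L[ℝ] ℝ) ∞ J
  d_eq : ∀ (ξ : GroupLieAlgebra IG G) (x : M) (v : TangentSpace I x),
    mfderiv I 𝓘(ℝ, ℝ) (fun y : M => J y ξ) x v = Ω x ![generator IG I ξ x, v]

/-- `Ad^*`-equivariance: `J(g • x) = Ad^*_{g⁻¹} (J(x))`. -/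
def IsAdEquivariant (J : M → LieDual IG G) : Prop :=
  ∀ (g : G) (x : M), J (g • x) = coAd IG g⁻¹ (J x)

end LieGroup

end ExactMomentum

end

noncomputable section

open Filter Topology

namespace ExactMomentum

section Vector

variable {W E : Type*} [NormedAddCommGroup W] [NormedSpace ℝ W] [NormedAddCommGroup E]
  [NormedSpace ℝ E]

/-- Evaluation of alternating `1`-forms on single vectors, as a continuous linear map. -/
def oneFormCLM (E : Type*) [NormedAddCommGroup E] [NormedSpace ℝ E] :
    (E [⋀^Fin 1]→L[ℝ] ℝ) →L[ℝ] (E →L[ℝ] ℝ) :=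
  (continuousMultilinearCurryFin1 ℝ E ℝ : _ →L[ℝ] _).comp
    (ContinuousAlternatingMap.toContinuousMultilinearMapCLM ℝ)

@[simp]
theorem oneFormCLM_apply (α : E [⋀^Fin 1]→L[ℝ] ℝ) (v : E) : oneFormCLM E α v = α ![v] := by
  change α (Fin.snoc 0 v) = α ![v]
  congr 1
  funext i
  fin_cases i
  rfl

theorem extDeriv_oneForm_apply {α : E → E [⋀^Fin 1]→L[ℝ] ℝ} {u : E} (v w : E) :
    extDeriv α u ![v, w] = fderiv ℝ α u v ![w] - fderiv ℝ α u w ![v] := by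
  rw [extDeriv, ContinuousAlternatingMap.alternatizeUncurryFin_apply]
  simp [Fin.sum_univ_two, sub_eq_add_neg]
  congr 2
  ext i
  fin_cases i
  rfl

/-- Cartan's formula for a one-form invariant under a family of maps `Φ w` near `Φ w₀ = id`. -/
theorem fderiv_contract_of_invariant {Φ : W × E → E} {α : E → E →L[ℝ] ℝ} {w₀ : W} {u₀ : E}
    (hΦ : ContDiffAt ℝ 2 Φ (w₀, u₀)) (hα : DifferentiableAt ℝ α u₀)
    (hid : ∀ᶠ u in 𝓝 u₀, Φ (w₀, u) = u)
    (hinv : ∀ᶠ w in 𝓝 w₀, ∀ v, α (Φ (w, u₀)) (fderiv ℝ Φ (w, u₀) (0, v)) = α u₀ v) (ξ : W) (v : E) :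
    fderiv ℝ (fun u => α u (fderiv ℝ Φ (w₀, u) (ξ, 0))) u₀ v =
      fderiv ℝ α u₀ v (fderiv ℝ Φ (w₀, u₀) (ξ, 0)) -
        fderiv ℝ α u₀ (fderiv ℝ Φ (w₀, u₀) (ξ, 0)) v := by
  have hΦ0 : Φ (w₀, u₀) = u₀ := hid.self_of_nhds
  have hd : HasFDerivAt Φ (fderiv ℝ Φ (w₀, u₀)) (w₀, u₀) :=
    (hΦ.differentiableAt (by simp)).hasFDerivAt
  have hdd : HasFDerivAt (fderiv ℝ Φ) (fderiv ℝ (fderiv ℝ Φ) (w₀, u₀)) (w₀, u₀) :=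
    ((hΦ.fderiv_right (m := 1) (by norm_num)).differentiableAt (by simp)).hasFDerivAt
  have hl : HasFDerivAt (fun w : W => (w, u₀)) (ContinuousLinearMap.inl ℝ W E) w₀ :=
    hasFDerivAt_prodMk_left w₀ u₀
  have hr : HasFDerivAt (fun u : E => (w₀, u)) (ContinuousLinearMap.inr ℝ W E) u₀ :=
    hasFDerivAt_prodMk_right w₀ u₀
  have hidv : fderiv ℝ Φ (w₀, u₀) (0, v) = v := by
    have h1 := hd.comp u₀ hr
    have h2 : HasFDerivAt (Φ ∘ fun u : E => (w₀, u)) (ContinuousLinearMap.id ℝ E) u₀ :=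
      (hasFDerivAt_id u₀).congr_of_eventuallyEq hid
    simpa using DFunLike.congr_fun (h1.unique h2) v
  have hα' : HasFDerivAt α (fderiv ℝ α u₀) (Φ (w₀, u₀)) := by
    rw [hΦ0]; exact hα.hasFDerivAt
  have h1 := (hα'.comp w₀ (hd.comp w₀ hl)).clm_apply
    ((hdd.comp w₀ hl).clm_apply (hasFDerivAt_const ((0 : W), v) w₀))
  have h2 : HasFDerivAt (fun w => (α ∘ Φ ∘ fun w => (w, u₀)) w
      ((fderiv ℝ Φ ∘ fun w => (w, u₀)) w (0, v))) (0 : W →L[ℝ] ℝ) w₀ :=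
    (hasFDerivAt_const (α u₀ v) w₀).congr_of_eventuallyEq (hinv.mono fun w hw => hw v)
  have h3 := DFunLike.congr_fun (h1.unique h2) ξ
  have h4 := hα.hasFDerivAt.clm_apply ((hdd.comp u₀ hr).clm_apply
    (hasFDerivAt_const (ξ, (0 : E)) u₀))
  have h5 : fderiv ℝ (fun u => α u (fderiv ℝ Φ (w₀, u) (ξ, 0))) u₀ = _ := h4.fderiv
  rw [h5]
  have hs := (hΦ.isSymmSndFDerivAt (by simp)).eq (ξ, 0) (0, v)
  simp [hΦ0, hidv] at h3 ⊢
  rw [hs] at h3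
  linarith

end Vector

section Action

variable {EG : Type*} [NormedAddCommGroup EG] [NormedSpace ℝ EG]
  {HG : Type*} [TopologicalSpace HG] (IG : ModelWithCorners ℝ EG HG)
  {G : Type*} [TopologicalSpace G] [ChartedSpace HG G] [Group G]
variable {E : Type*} [NormedAddCommGroup E] [NormedSpace ℝ E]
  {H : Type*} [TopologicalSpace H] (I : ModelWithCorners ℝ E H)
  {M : Type*} [TopologicalSpace M] [ChartedSpace H M] [MulAction G M]
  [ContMDiffSMul IG I ∞ G M]

theorem mdifferentiableAt_smul (p : G × M) :
    MDifferentiableAt (IG.prod I) I (fun p : G × M => p.1 • p.2) p :=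
  ((ContMDiffSMul.contMDiff_smul (I := IG) (I' := I) (n := ∞)) p).mdifferentiableAt (by simp)

theorem mdifferentiableAt_smul_const (g : G) (x : M) :
    MDifferentiableAt IG I (fun g : G => g • x) g :=
  (mdifferentiableAt_smul IG I (g, x)).comp g (mdifferentiableAt_id.prodMk mdifferentiableAt_const)

include IG in
theorem mdifferentiableAt_const_smul (g : G) (x : M) :
    MDifferentiableAt I I (fun x : M => g • x) x :=
  (mdifferentiableAt_smul IG I (g, x)).comp x (mdifferentiableAt_const.prodMk mdifferentiableAt_id)

end Action

section LieGroup

variable {EG : Type*} [NormedAddCommGroup EG] [NormedSpace ℝ EG]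
  {HG : Type*} [TopologicalSpace HG] (IG : ModelWithCorners ℝ EG HG)
  {G : Type*} [TopologicalSpace G] [ChartedSpace HG G] [Group G]
  [FiniteDimensional ℝ EG] [IG.Boundaryless] [LieGroup IG ∞ G]

theorem expCurve_zero (ξ : GroupLieAlgebra IG G) : expCurve IG ξ 0 = 1 :=
  (exists_integralCurve IG ξ).choose_spec.1

theorem isMIntegralCurve_expCurve (ξ : GroupLieAlgebra IG G) :
    IsMIntegralCurve (expCurve IG ξ) (mulInvariantVectorField (I := IG) ξ) :=
  (exists_integralCurve IG ξ).choose_spec.2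

theorem lieExp_smul (ξ : GroupLieAlgebra IG G) (t : ℝ) : lieExp IG (t • ξ) = expCurve IG ξ t := by
  have : CompleteSpace EG := FiniteDimensional.complete ℝ EG
  have : IsManifold IG 1 G := IsManifold.of_le (m := 1) (n := ∞) (by simp)
  have : LieGroup IG (minSmoothness ℝ 3) G := by
    rw [minSmoothness_of_isRCLikeNormedField]; infer_instance
  have : IsTopologicalGroup G := topologicalGroup_of_lieGroup IG ∞
  have : T1Space G := IG.t1Space G
  have hv : ContMDiff IG IG.tangent 1 (fun g : G =>
      (⟨g, mulInvariantVectorField (I := IG) (t • ξ) g⟩ : TangentBundle IG G)) :=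
    (contMDiff_mulInvariantVectorField (t • ξ)).of_le (by simp)
  have h1 := (isMIntegralCurve_expCurve IG ξ).comp_mul t
  rw [← mulInvariantVectorField_smul] at h1
  have h2 := isMIntegralCurve_Ioo_eq_of_contMDiff_boundaryless (t₀ := 0) hv
    (isMIntegralCurve_expCurve IG (t • ξ)) h1 (by simp [expCurve_zero])
  simpa [lieExp] using congrFun h2 1

theorem hasMFDerivAt_lieExp_smul (ξ : GroupLieAlgebra IG G) :
    HasMFDerivAt 𝓘(ℝ, ℝ) IG (fun t : ℝ => lieExp IG (t • ξ)) 0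
      ((1 : ℝ →L[ℝ] ℝ).smulRight (ξ : EG)) := by
  have h := isMIntegralCurve_expCurve IG ξ 0
  rw [show (fun t : ℝ => lieExp IG (t • ξ)) = expCurve IG ξ from funext (lieExp_smul IG ξ)]
  have hg : ∀ g : G, g = 1 → (mulInvariantVectorField (I := IG) ξ g : EG) = (ξ : EG) := by
    rintro g rfl
    have h1 := ((hasMFDerivAt_id (I := IG) (1 : G)).congr_of_eventuallyEq
      (f₁ := fun y : G => 1 * y) (by simp [EventuallyEq])).mfderiv
    exact DFunLike.congr_fun h1 (ξ : EG)
  exact h.congr_mfderiv (congrArg _ (hg _ (expCurve_zero IG ξ)))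

variable {E : Type*} [NormedAddCommGroup E] [NormedSpace ℝ E]
  {H : Type*} [TopologicalSpace H] (I : ModelWithCorners ℝ E H)
  {M : Type*} [TopologicalSpace M] [ChartedSpace H M] [MulAction G M]
  [ContMDiffSMul IG I ∞ G M]

/-- The generator is the derivative of the orbit map at the identity. -/
theorem generator_eq (ξ : GroupLieAlgebra IG G) (x : M) :
    (generator IG I ξ x : E) = (mfderiv IG I (fun g : G => g • x) 1 : EG →L[ℝ] E) ξ := by
  have h := hasMFDerivAt_lieExp_smul IG ξ
  have h0 : lieExp IG ((0 : ℝ) • ξ) = 1 := by rw [lieExp_smul, expCurve_zero]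
  have h1 : HasMFDerivAt IG I (fun g : G => g • x) (lieExp IG ((0 : ℝ) • ξ))
      (mfderiv IG I (fun g : G => g • x) 1 : EG →L[ℝ] E) := by
    rw [h0]; exact (mdifferentiableAt_smul_const IG I 1 x).hasMFDerivAt
  have h2 := (h1.comp (0 : ℝ) h).mfderiv
  have h3 := DFunLike.congr_fun h2 (1 : ℝ)
  refine h3.trans ?_
  change (mfderiv IG I (fun g : G => g • x) 1 : EG →L[ℝ] E) ((1 : ℝ) • (ξ : EG)) = _
  exact congrArg _ (one_smul ℝ (ξ : EG))

end LieGroup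

section Charts

variable {E : Type*} [NormedAddCommGroup E] [NormedSpace ℝ E]
  {H : Type*} [TopologicalSpace H] (I : ModelWithCorners ℝ E H)
  {M : Type*} [TopologicalSpace M] [ChartedSpace H M]

theorem Form.d_apply (Ω : Form I M 1) (x : M) (v w : E) :
    (Form.d I Ω x : E [⋀^Fin 2]→L[ℝ] ℝ) ![v, w] =
      extDeriv (Form.inChart I Ω x) (extChartAt I x x)
        ![(mfderiv I 𝓘(ℝ, E) (extChartAt I x) x : E →L[ℝ] E) v,
          (mfderiv I 𝓘(ℝ, E) (extChartAt I x) x : E →L[ℝ] E) w] := by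
  refine congrArg (extDeriv (Form.inChart I Ω x) (extChartAt I x x)) ?_
  funext i
  fin_cases i <;> rfl

variable [IsManifold I ∞ M]

theorem mdifferentiableAt_extChartAt_of_mem {x y : M} (hy : y ∈ (extChartAt I x).source) :
    MDifferentiableAt I 𝓘(ℝ, E) (extChartAt I x) y := by
  have : IsManifold I 1 M := IsManifold.of_le (m := 1) (n := ∞) (by simp)
  exact mdifferentiableAt_extChartAt (by rwa [← extChartAt_source (I := I)])

variable [I.Boundaryless]

theorem mdifferentiableAt_extChartAt_symm {x : M} {u : E} (hu : u ∈ (extChartAt I x).target) :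
    MDifferentiableAt 𝓘(ℝ, E) I (extChartAt I x).symm u := by
  have : IsManifold I 1 M := IsManifold.of_le (m := 1) (n := ∞) (by simp)
  have h := mdifferentiableWithinAt_extChartAt_symm (I := I) hu
  rwa [I.range_eq_univ, mdifferentiableWithinAt_univ] at h

theorem mfderiv_extChartAt_symm_mfderiv_extChartAt {x y : M} (hy : y ∈ (extChartAt I x).source)
    (z : E) :
    (mfderiv 𝓘(ℝ, E) I (extChartAt I x).symm (extChartAt I x y) : E →L[ℝ] E)
      ((mfderiv I 𝓘(ℝ, E) (extChartAt I x) y : E →L[ℝ] E) z) = z := by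
  have : IsManifold I 1 M := IsManifold.of_le (m := 1) (n := ∞) (by simp)
  have h := mfderivWithin_extChartAt_symm_comp_mfderiv_extChartAt' (I := I) hy
  rw [I.range_eq_univ, mfderivWithin_univ] at h
  exact DFunLike.congr_fun h z

theorem Form.inChart_apply_mfderiv (Ω : Form I M 1) {x y : M} (hy : y ∈ (extChartAt I x).source)
    (z : E) :
    Form.inChart I Ω x (extChartAt I x y)
      ![(mfderiv I 𝓘(ℝ, E) (extChartAt I x) y : E →L[ℝ] E) z] = (Ω y : E [⋀^Fin 1]→L[ℝ] ℝ) ![z] := by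
  have key : ∀ y', y' = y → ∀ z' : E, z' = z → ∀ w : Fin 1 → E, w 0 = z' →
      (Ω y' : E [⋀^Fin 1]→L[ℝ] ℝ) w = (Ω y : E [⋀^Fin 1]→L[ℝ] ℝ) ![z] := by
    rintro _ rfl _ rfl w hw
    congr 1
    funext i
    fin_cases i
    exact hw
  exact key _ ((extChartAt I x).left_inv hy) _
    (mfderiv_extChartAt_symm_mfderiv_extChartAt I hy z) _ rfl

end Charts

section ChartAction

variable {EG : Type*} [NormedAddCommGroup EG] [NormedSpace ℝ EG]
  {HG : Type*} [TopologicalSpace HG] (IG : ModelWithCorners ℝ EG HG)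
  {G : Type*} [TopologicalSpace G] [ChartedSpace HG G] [Group G]
  {E : Type*} [NormedAddCommGroup E] [NormedSpace ℝ E]
  {H : Type*} [TopologicalSpace H] (I : ModelWithCorners ℝ E H)
  {M : Type*} [TopologicalSpace M] [ChartedSpace H M] [MulAction G M]

variable (G) in
/-- The action in the charts around `1` and `x₀`. -/
def chartAction (x₀ : M) (p : EG × E) : E :=
  extChartAt I x₀ ((extChartAt IG (1 : G)).symm p.1 • (extChartAt I x₀).symm p.2)

theorem one_smul_mem_source {x₀ x : M} (hx : x ∈ (extChartAt I x₀).source) :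
    (extChartAt IG (1 : G)).symm (extChartAt IG (1 : G) 1) •
      (extChartAt I x₀).symm (extChartAt I x₀ x) ∈ (extChartAt I x₀).source := by
  rwa [(extChartAt I x₀).left_inv hx, extChartAt_to_inv, one_smul]

theorem chartAction_one (x₀ : M) {u : E} (hu : u ∈ (extChartAt I x₀).target) :
    chartAction IG G I x₀ (extChartAt IG (1 : G) 1, u) = u := by
  rw [chartAction, extChartAt_to_inv, one_smul, (extChartAt I x₀).right_inv hu]

variable [IG.Boundaryless] [LieGroup IG ∞ G] [I.Boundaryless] [IsManifold I ∞ M]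
  [ContMDiffSMul IG I ∞ G M]

theorem contDiffAt_chartAction {x₀ : M} {w : EG} {u : E}
    (hw : w ∈ (extChartAt IG (1 : G)).target) (hu : u ∈ (extChartAt I x₀).target)
    (h : (extChartAt IG (1 : G)).symm w • (extChartAt I x₀).symm u ∈ (extChartAt I x₀).source) :
    ContDiffAt ℝ ∞ (chartAction IG G I x₀) (w, u) := by
  have h1 : ContMDiffAt 𝓘(ℝ, EG) IG ∞ (extChartAt IG (1 : G)).symm w :=
    (contMDiffOn_extChartAt_symm (1 : G)).contMDiffAt (extChartAt_target_mem_nhds' hw)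
  have h2 : ContMDiffAt 𝓘(ℝ, E) I ∞ (extChartAt I x₀).symm u :=
    (contMDiffOn_extChartAt_symm x₀).contMDiffAt (extChartAt_target_mem_nhds' hu)
  have h3 : ContMDiffAt 𝓘(ℝ, EG × E) IG ∞ (fun p : EG × E => (extChartAt IG (1 : G)).symm p.1)
      (w, u) := h1.comp (w, u) contDiffAt_fst.contMDiffAt
  have h4 : ContMDiffAt 𝓘(ℝ, EG × E) I ∞ (fun p : EG × E => (extChartAt I x₀).symm p.2)
      (w, u) := h2.comp (w, u) contDiffAt_snd.contMDiffAt
  have h5 := ContMDiffSMul.contMDiff_smul (I := IG) (I' := I) (n := ∞)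
    ((extChartAt IG (1 : G)).symm w, (extChartAt I x₀).symm u)
  have h6 := h5.comp (w, u) (h3.prodMk h4)
  have h7 : ContMDiffAt I 𝓘(ℝ, E) ∞ (extChartAt I x₀)
      ((extChartAt IG (1 : G)).symm w • (extChartAt I x₀).symm u) :=
    contMDiffAt_extChartAt' (by rwa [← extChartAt_source (I := I)])
  exact (h7.comp (w, u) h6).contDiffAt

theorem contDiffAt_chartAction_one {x₀ x : M} (hx : x ∈ (extChartAt I x₀).source) :
    ContDiffAt ℝ ∞ (chartAction IG G I x₀) (extChartAt IG (1 : G) 1, extChartAt I x₀ x) :=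
  contDiffAt_chartAction IG I (mem_extChartAt_target 1) ((extChartAt I x₀).map_source hx)
    (one_smul_mem_source IG I hx)

theorem fderiv_chartAction_inl {x₀ x : M} (hx : x ∈ (extChartAt I x₀).source) (ξ : EG) :
    fderiv ℝ (chartAction IG G I x₀) (extChartAt IG (1 : G) 1, extChartAt I x₀ x)
      ((mfderiv IG 𝓘(ℝ, EG) (extChartAt IG (1 : G)) 1 : EG →L[ℝ] EG) ξ, 0) =
    (mfderiv I 𝓘(ℝ, E) (extChartAt I x₀) x : E →L[ℝ] E)
      ((mfderiv IG I (fun g : G => g • x) 1 : EG →L[ℝ] E) ξ) := by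
  have hF := ((contDiffAt_chartAction_one IG (G := G) I hx).differentiableAt (by simp)).hasFDerivAt
  have h1 : HasMFDerivAt 𝓘(ℝ, EG) 𝓘(ℝ, E)
      (fun w => chartAction IG G I x₀ (w, extChartAt I x₀ x)) (extChartAt IG (1 : G) 1) _ :=
    (HasFDerivAt.comp (g := chartAction IG G I x₀) (f := fun w => (w, extChartAt I x₀ x))
      (extChartAt IG (1 : G) 1) hF (hasFDerivAt_prodMk_left _ _)).hasMFDerivAt
  have h2 := h1.comp (1 : G)
    (mdifferentiableAt_extChartAt_of_mem IG (mem_extChartAt_source (1 : G))).hasMFDerivAt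
  have h3 : HasMFDerivAt I 𝓘(ℝ, E) (extChartAt I x₀) ((1 : G) • x)
      (mfderiv I 𝓘(ℝ, E) (extChartAt I x₀) x : E →L[ℝ] E) := by
    rw [one_smul]; exact (mdifferentiableAt_extChartAt_of_mem I hx).hasMFDerivAt
  have h4 := h3.comp (1 : G) (mdifferentiableAt_smul_const IG I (1 : G) x).hasMFDerivAt
  have h5 : ((fun w => chartAction IG G I x₀ (w, extChartAt I x₀ x)) ∘ extChartAt IG (1 : G))
      =ᶠ[𝓝 1] (extChartAt I x₀ ∘ fun g : G => g • x) := by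
    filter_upwards [extChartAt_source_mem_nhds (I := IG) (1 : G)] with g hg
    simp only [Function.comp_apply, chartAction, (extChartAt I x₀).left_inv hx,
      (extChartAt IG (1 : G)).left_inv hg]
  exact DFunLike.congr_fun (hasMFDerivAt_unique h2 (h4.congr_of_eventuallyEq h5)) ξ

theorem fderiv_chartAction_inr {x₀ : M} {w : EG} {u : E}
    (hw : w ∈ (extChartAt IG (1 : G)).target) (hu : u ∈ (extChartAt I x₀).target)
    (h : (extChartAt IG (1 : G)).symm w • (extChartAt I x₀).symm u ∈ (extChartAt I x₀).source)
    (v : E) :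
    fderiv ℝ (chartAction IG G I x₀) (w, u) (0, v) =
    (mfderiv I 𝓘(ℝ, E) (extChartAt I x₀)
        ((extChartAt IG (1 : G)).symm w • (extChartAt I x₀).symm u) : E →L[ℝ] E)
      ((mfderiv I I (fun x : M => (extChartAt IG (1 : G)).symm w • x)
          ((extChartAt I x₀).symm u) : E →L[ℝ] E)
        ((mfderiv 𝓘(ℝ, E) I (extChartAt I x₀).symm u : E →L[ℝ] E) v)) := by
  have hF := ((contDiffAt_chartAction IG I hw hu h).differentiableAt (by simp)).hasFDerivAt
  have h1 : HasMFDerivAt 𝓘(ℝ, E) 𝓘(ℝ, E) (fun u => chartAction IG G I x₀ (w, u)) u _ :=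
    (HasFDerivAt.comp (g := chartAction IG G I x₀) (f := fun u => (w, u))
      u hF (hasFDerivAt_prodMk_right _ _)).hasMFDerivAt
  have h2 := (mdifferentiableAt_extChartAt_of_mem I h).hasMFDerivAt.comp u
    ((mdifferentiableAt_const_smul IG I ((extChartAt IG (1 : G)).symm w) _).hasMFDerivAt.comp u
      (mdifferentiableAt_extChartAt_symm I hu).hasMFDerivAt)
  exact DFunLike.congr_fun (hasMFDerivAt_unique h1 h2) v

theorem inChart_chartAction_of_invariant (θ : Form I M 1)
    (hθ : ∀ g : G, Form.pullback I I (fun x : M => g • x) θ = θ) {x₀ : M} {w : EG} {u : E}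
    (hw : w ∈ (extChartAt IG (1 : G)).target) (hu : u ∈ (extChartAt I x₀).target)
    (h : (extChartAt IG (1 : G)).symm w • (extChartAt I x₀).symm u ∈ (extChartAt I x₀).source)
    (v : E) :
    Form.inChart I θ x₀ (chartAction IG G I x₀ (w, u))
      ![fderiv ℝ (chartAction IG G I x₀) (w, u) (0, v)] = Form.inChart I θ x₀ u ![v] := by
  rw [fderiv_chartAction_inr IG I hw hu h]
  refine (Form.inChart_apply_mfderiv I θ h _).trans ?_
  have h1 := DFunLike.congr_fun (congrFun (hθ ((extChartAt IG (1 : G)).symm w))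
    ((extChartAt I x₀).symm u)) ![(mfderiv 𝓘(ℝ, E) I (extChartAt I x₀).symm u : E →L[ℝ] E) v]
  refine Eq.trans ?_ (h1.trans ?_)
  · refine congrArg (θ ((extChartAt IG (1 : G)).symm w • (extChartAt I x₀).symm u)) ?_
    funext i
    fin_cases i
    rfl
  · refine congrArg (θ ((extChartAt I x₀).symm u)) ?_
    funext i
    fin_cases i
    rfl

end ChartAction

section Momentum

theorem contDiffAt_inChart {E : Type*} [NormedAddCommGroup E] [NormedSpace ℝ E]
    {H : Type*} [TopologicalSpace H] (I : ModelWithCorners ℝ E H) [I.Boundaryless]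
    {M : Type*} [TopologicalSpace M] [ChartedSpace H M] {θ : Form I M 1}
    (hθ : Form.IsSmooth I θ) (x₀ : M) :
    ContDiffAt ℝ ∞ (Form.inChart I θ x₀) (extChartAt I x₀ x₀) :=
  (hθ x₀).contDiffAt (extChartAt_target_mem_nhds x₀)

variable {EG : Type*} [NormedAddCommGroup EG] [NormedSpace ℝ EG]
  {HG : Type*} [TopologicalSpace HG] (IG : ModelWithCorners ℝ EG HG)
  {G : Type*} [TopologicalSpace G] [ChartedSpace HG G] [Group G]
  {E : Type*} [NormedAddCommGroup E] [NormedSpace ℝ E]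
  {H : Type*} [TopologicalSpace H] (I : ModelWithCorners ℝ E H)
  {M : Type*} [TopologicalSpace M] [ChartedSpace H M] [MulAction G M]

/-- The momentum map `J(x) ξ = θ_x(ξ_M(x))`, with `ξ_M(x)` expressed as the derivative of the orbit
map at the identity. -/
def momentum (θ : Form I M 1) (x : M) : LieDual IG G :=
  (oneFormCLM E (θ x)).comp (mfderiv IG I (fun g : G => g • x) 1 : EG →L[ℝ] E)

theorem momentum_apply (θ : Form I M 1) (x : M) (ξ : EG) :
    (momentum IG I θ x : LieDual IG G) ξ =
      (θ x : E [⋀^Fin 1]→L[ℝ] ℝ) ![(mfderiv IG I (fun g : G => g • x) 1 : EG →L[ℝ] E) ξ] :=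
  oneFormCLM_apply _ _

variable [LieGroup IG ∞ G] [ContMDiffSMul IG I ∞ G M]

theorem mfderiv_orbit_smul (g : G) (x : M) (ξ : EG) :
    (mfderiv IG I (fun h : G => h • g • x) 1 : EG →L[ℝ] E) ξ =
      (mfderiv I I (fun y : M => g • y) x : E →L[ℝ] E)
        ((mfderiv IG I (fun h : G => h • x) 1 : EG →L[ℝ] E) (Ad IG g⁻¹ ξ)) := by
  have h1 : HasMFDerivAt IG IG (fun h : G => g⁻¹ * h * g⁻¹⁻¹) 1 (Ad IG g⁻¹ : EG →L[ℝ] EG) :=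
    (((contMDiff_mul_right (I := IG) (n := ∞) (a := g⁻¹⁻¹)).comp
      (contMDiff_mul_left (I := IG) (n := ∞) (a := g⁻¹))).mdifferentiableAt
        (by simp)).hasMFDerivAt
  have h2 : HasMFDerivAt IG I (fun h : G => h • x) (g⁻¹ * 1 * g⁻¹⁻¹)
      (mfderiv IG I (fun h : G => h • x) 1 : EG →L[ℝ] E) := by
    rw [mul_one, mul_inv_cancel]
    exact (mdifferentiableAt_smul_const IG I (1 : G) x).hasMFDerivAt
  have h3 : HasMFDerivAt I I (fun y : M => g • y) ((g⁻¹ * 1 * g⁻¹⁻¹) • x)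
      (mfderiv I I (fun y : M => g • y) x : E →L[ℝ] E) := by
    rw [mul_one, mul_inv_cancel, one_smul]
    exact (mdifferentiableAt_const_smul IG I g x).hasMFDerivAt
  have h4 := h3.comp (1 : G) (h2.comp (1 : G) h1)
  have h5 : ((fun y : M => g • y) ∘ (fun h : G => h • x) ∘ fun h : G => g⁻¹ * h * g⁻¹⁻¹) =
      fun h : G => h • g • x := by
    funext h
    simp [smul_smul, mul_assoc]
  rw [h5] at h4
  exact DFunLike.congr_fun h4.mfderiv ξ

theorem isAdEquivariant_momentum (θ : Form I M 1)
    (hθ : ∀ g : G, Form.pullback I I (fun x : M => g • x) θ = θ) :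
    IsAdEquivariant IG (momentum IG I θ : M → LieDual IG G) := by
  intro g x
  refine ContinuousLinearMap.ext fun ξ => ?_
  refine (momentum_apply IG I θ (g • x) ξ).trans ?_
  refine Eq.trans ?_ (momentum_apply IG I θ x (Ad IG g⁻¹ ξ)).symm
  refine (congrArg (fun z : E => (θ (g • x) : E [⋀^Fin 1]→L[ℝ] ℝ) ![z])
    (mfderiv_orbit_smul IG I g x ξ)).trans ?_
  refine Eq.trans ?_ (DFunLike.congr_fun (congrFun (hθ g) x)
    ![(mfderiv IG I (fun h : G => h • x) 1 : EG →L[ℝ] E) (Ad IG g⁻¹ ξ)])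
  refine congrArg (θ (g • x)) ?_
  funext i
  fin_cases i
  rfl

variable [IG.Boundaryless] [I.Boundaryless] [IsManifold I ∞ M]

theorem momentum_eq_inChart (θ : Form I M 1) {x₀ x : M} (hx : x ∈ (extChartAt I x₀).source) :
    (momentum IG I θ x : EG →L[ℝ] ℝ) =
      (oneFormCLM E (Form.inChart I θ x₀ (extChartAt I x₀ x))).comp
        ((fderiv ℝ (chartAction IG G I x₀) (extChartAt IG (1 : G) 1, extChartAt I x₀ x)).comp
          ((ContinuousLinearMap.inl ℝ EG E).comp
            (mfderiv IG 𝓘(ℝ, EG) (extChartAt IG (1 : G)) 1 : EG →L[ℝ] EG))) := by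
  refine ContinuousLinearMap.ext fun ξ => (momentum_apply IG I θ x ξ).trans ?_
  refine (Form.inChart_apply_mfderiv I θ hx _).symm.trans ?_
  refine (congrArg (fun z : E => Form.inChart I θ x₀ (extChartAt I x₀ x) ![z])
    (fderiv_chartAction_inl IG I hx ξ).symm).trans ?_
  exact (oneFormCLM_apply _ _).symm

theorem contMDiff_momentum {θ : Form I M 1} (hθ : Form.IsSmooth I θ) :
    ContMDiff (M' := EG →L[ℝ] ℝ) I 𝓘(ℝ, EG →L[ℝ] ℝ) ∞
      (momentum IG I θ : M → LieDual IG G) := by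
  intro x₀
  have h1 := (oneFormCLM E).contDiff.contDiffAt.comp _ (contDiffAt_inChart I hθ x₀)
  have h2 := ((contDiffAt_chartAction_one IG (G := G) I (mem_extChartAt_source x₀)).fderiv_right
    (m := ∞) (by simp)).comp (extChartAt I x₀ x₀)
      (contDiffAt_const (c := extChartAt IG (1 : G) 1)|>.prodMk contDiffAt_id)
  let A : EG →L[ℝ] EG := mfderiv IG 𝓘(ℝ, EG) (extChartAt IG (1 : G)) 1
  have h3 := h1.clm_comp (h2.clm_comp (contDiffAt_const
    (c := (ContinuousLinearMap.inl ℝ EG E).comp A)))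
  refine (h3.contMDiffAt.comp x₀ contMDiffAt_extChartAt).congr_of_eventuallyEq ?_
  filter_upwards [extChartAt_source_mem_nhds (I := I) x₀] with x hx
  exact momentum_eq_inChart IG I θ hx

theorem mfderiv_momentum_apply {θ : Form I M 1} (hθ : Form.IsSmooth I θ)
    (hinv : ∀ g : G, Form.pullback I I (fun x : M => g • x) θ = θ) (ξ : EG) (x : M) (v : E) :
    (mfderiv I 𝓘(ℝ, ℝ) (fun y : M => (momentum IG I θ y : LieDual IG G) ξ) x : E →L[ℝ] ℝ) v =
      -(Form.d I θ x : E [⋀^Fin 2]→L[ℝ] ℝ)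
        ![(mfderiv IG I (fun g : G => g • x) 1 : EG →L[ℝ] E) ξ, v] := by
  have h2 : (2 : ℕ∞ω) ≤ ∞ := WithTop.coe_le_coe.2 (le_top (a := (2 : ℕ∞)))
  set w₀ := extChartAt IG (1 : G) 1
  set u₀ := extChartAt I x x
  set Φ := chartAction IG G I x
  set η : EG := (mfderiv IG 𝓘(ℝ, EG) (extChartAt IG (1 : G)) 1 : EG →L[ℝ] EG) ξ
  have hx := mem_extChartAt_source (I := I) x
  have hΦ : ContDiffAt ℝ ∞ Φ (w₀, u₀) := contDiffAt_chartAction_one IG I hx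
  have hα := (contDiffAt_inChart I hθ x).differentiableAt (by simp)
  have hα' := (oneFormCLM E).hasFDerivAt.comp u₀ hα.hasFDerivAt
  have hid : ∀ᶠ u in 𝓝 u₀, Φ (w₀, u) = u := by
    filter_upwards [extChartAt_target_mem_nhds (I := I) x] with u hu
    exact chartAction_one IG I x hu
  have hmem : ∀ᶠ w in 𝓝 w₀, (extChartAt IG (1 : G)).symm w • (extChartAt I x).symm u₀ ∈
      (extChartAt I x).source := by
    have hc : ContinuousAt (fun w => (extChartAt IG (1 : G)).symm w • (extChartAt I x).symm u₀)
        w₀ := by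
      have h1 : ContinuousAt (fun g : G => g • (extChartAt I x).symm u₀)
        ((extChartAt IG (1 : G)).symm w₀) := (mdifferentiableAt_smul_const IG I _ _).continuousAt
      exact h1.comp (continuousAt_extChartAt_symm (1 : G))
    refine hc (extChartAt_source_mem_nhds' ?_)
    exact one_smul_mem_source IG I hx
  have hinv' : ∀ᶠ w in 𝓝 w₀, ∀ v, (oneFormCLM E ∘ Form.inChart I θ x) (Φ (w, u₀))
      (fderiv ℝ Φ (w, u₀) (0, v)) = (oneFormCLM E ∘ Form.inChart I θ x) u₀ v := by
    filter_upwards [extChartAt_target_mem_nhds (I := IG) (1 : G), hmem] with w hw hw' v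
    simp only [Function.comp_apply, oneFormCLM_apply]
    exact inChart_chartAction_of_invariant IG I θ hinv hw (mem_extChartAt_target x) hw' v
  have key := fderiv_contract_of_invariant (hΦ.of_le h2) hα'.differentiableAt hid hinv' η
    ((mfderiv I 𝓘(ℝ, E) (extChartAt I x) x : E →L[ℝ] E) v)
  have hk : DifferentiableAt ℝ
      (fun u => (oneFormCLM E ∘ Form.inChart I θ x) u (fderiv ℝ Φ (w₀, u) (η, 0))) u₀ := by
    have hdd := (hΦ.fderiv_right (m := 1) (by rwa [one_add_one_eq_two])).differentiableAt (by simp)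
    exact hα'.differentiableAt.clm_apply ((hdd.comp u₀ (by fun_prop)).clm_apply (by fun_prop))
  have hJ : HasMFDerivAt I 𝓘(ℝ, ℝ) (fun y : M => (momentum IG I θ y : LieDual IG G) ξ) x _ :=
    (hk.hasFDerivAt.hasMFDerivAt.comp x
      (mdifferentiableAt_extChartAt_of_mem I hx).hasMFDerivAt).congr_of_eventuallyEq <| by
        filter_upwards [extChartAt_source_mem_nhds (I := I) x] with y hy
        exact DFunLike.congr_fun (momentum_eq_inChart IG I θ hy) ξ
  refine (DFunLike.congr_fun hJ.mfderiv v).trans (key.trans ?_)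
  have hd : ∀ X Y : E, fderiv ℝ (oneFormCLM E ∘ Form.inChart I θ x) u₀ Y X -
      fderiv ℝ (oneFormCLM E ∘ Form.inChart I θ x) u₀ X Y =
        -extDeriv (Form.inChart I θ x) u₀ ![X, Y] := by
    intro X Y
    rw [extDeriv_oneForm_apply, hα'.fderiv]
    simp [u₀]
  refine (hd _ _).trans (Eq.trans ?_ (congrArg Neg.neg (Form.d_apply I θ x _ v)).symm)
  exact congrArg (fun X : E => -extDeriv (Form.inChart I θ x) u₀
    ![X, (mfderiv I 𝓘(ℝ, E) (extChartAt I x) x : E →L[ℝ] E) v])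
      (fderiv_chartAction_inl IG (G := G) I hx ξ)

end Momentum

end ExactMomentum

end

theorem mainTheorem4
    -- the Lie group
    {EG : Type*} [NormedAddCommGroup EG] [NormedSpace ℝ EG] [FiniteDimensional ℝ EG]
    {HG : Type*} [TopologicalSpace HG] (IG : ModelWithCorners ℝ EG HG) [IG.Boundaryless]
    {G : Type*} [TopologicalSpace G] [ChartedSpace HG G] [Group G] [LieGroup IG ∞ G]
    -- the manifold
    {E : Type*} [NormedAddCommGroup E] [NormedSpace ℝ E] [FiniteDimensional ℝ E]
    {H : Type*} [TopologicalSpace H] (I : ModelWithCorners ℝ E H) [I.Boundaryless]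
    {M : Type*} [TopologicalSpace M] [ChartedSpace H M] [IsManifold I ∞ M]
    -- the smooth action
    [MulAction G M] [ContMDiffSMul IG I ∞ G M]
    -- the exact symplectic form
    (Ω : ExactMomentum.Form I M 2) (hΩ : ExactMomentum.IsSymplecticForm I Ω)
    (θ : ExactMomentum.Form I M 1) (hθ : ExactMomentum.Form.IsSmooth I θ)
    (hΩθ : Ω = -ExactMomentum.Form.d I θ)
    -- the action is symplectic and preserves the potential
    (hΦΩ : ∀ g : G, ExactMomentum.Form.pullback I I (fun x : M => g • x) Ω = Ω)
    (hΦθ : ∀ g : G, ExactMomentum.Form.pullback I I (fun x : M => g • x) θ = θ) :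
    ∃ J : M → ExactMomentum.LieDual IG G,
      (∀ (x : M) (ξ : GroupLieAlgebra IG G),
        J x ξ = θ x ![ExactMomentum.generator IG I ξ x]) ∧
      ExactMomentum.IsMomentumMap IG I Ω J ∧
      ExactMomentum.IsAdEquivariant IG J := by
  refine ⟨ExactMomentum.momentum IG I θ, fun x ξ => ?_,
    ⟨ExactMomentum.contMDiff_momentum IG I hθ, fun ξ x v => ?_⟩,
    ExactMomentum.isAdEquivariant_momentum IG I θ hΦθ⟩
  · rw [ExactMomentum.generator_eq]
    exact ExactMomentum.momentum_apply IG I θ x ξ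
  · rw [ExactMomentum.generator_eq, hΩθ]
    exact ExactMomentum.mfderiv_momentum_apply IG I hθ hΦθ ξ x v
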